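/- Let $m,d\ge 1$, let $\mathcal H_m=\mathbb C^m$ and $\mathcal H_d=\mathbb C^d$ with their standard orthonormal bases, and write $\mathrm L(\mathcal H)$ for the linear operators on $\mathcal H$. Let $\Phi:\mathrm L(\mathcal H_d)\to\mathrm L(\mathcal H_d)$ be a quantum channel (a completely positive, trace-preserving linear map), and let $K(\Phi)=\mathrm{span}\{E_k\}$ be its Kraus operator space, where $\Phi(X)=\sum_k E_kXE_k^\dagger$ is a Kraus representation of $\Phi$ (the span does not depend on the representation). With $|L|=\sqrt{L^\dagger L}$, put $$C_\Phi=\inf_{L\in K(\Phi)}\frac{\mathrm{Tr}\,(|L|-I_d)^2}{d}.$$ Let $\Psi$ be a Schur channel on $\mathrm L(\mathcal H_m)$, i.e. $\Psi(X)=[s_{kj}x_{kj}]_{k,j}$ for some positive semidefinite $S=[s_{kj}]\in \mathrm L(\mathcal H_m)$ with $s_{kk}=1$ for all $k$. Then $$D\bigl(\Psi\otimes\Phi,\ \mathrm{Conv}(\mathbf U(\mathcal H_m\otimes\mathcal H_d))\bigr)\ \ge\ C_\Phi .$$ Here $\mathbf U(\mathcal H)$ is the set of unitary channels $X\mapsto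 UXU^\dagger$ with $U$ unitary on $\mathcal H$, $\mathrm{Conv}$ is the convex hull, and $D(\Theta,\mathcal C)=\inf_{\Lambda\in\mathcal C}\|\Theta-\Lambda\|_\diamond$, where $\|\Theta\|_\diamond=\sup_{n\ge1}\ \sup_{\|X\|_1\le 1}\|(\Theta\otimes \mathrm{id}_{\mathrm L(\mathbb C^n)})(X)\|_1$ is the diamond norm and $\|X\|_1=\mathrm{Tr}\,|X|$. -/

import Mathlib

open scoped Matrix ComplexOrder MatrixOrder Kronecker ENNReal

namespace QChannel

/-- Linear operators on the Hilbert space `ℂ^ι` (with its standard orthonormal basis). -/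
abbrev Op (ι : Type*) := Matrix ι ι ℂ

/-- Super-operators on `ℂ^ι`: complex-linear maps from operators to operators. -/
abbrev SuperOp (ι : Type*) := Op ι →ₗ[ℂ] Op ι

section

variable {ι κ : Type*} [Fintype ι] [DecidableEq ι] [Fintype κ] [DecidableEq κ]

/-- The tensor product `Ψ ⊗ Φ` of super-operators, as a super-operator on `ℂ^κ ⊗ ℂ^ι = ℂ^(κ × ι)`. -/
noncomputable def tensor (Ψ : SuperOp κ) (Φ : SuperOp ι) : SuperOp (κ × ι) :=
  (kroneckerLinearEquiv κ κ ι ι ℂ).toLinearMap ∘ₗ TensorProduct.map Ψ Φ ∘ₗ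
    (kroneckerLinearEquiv κ κ ι ι ℂ).symm.toLinearMap

theorem tensor_kronecker (Ψ : SuperOp κ) (Φ : SuperOp ι) (A : Op κ) (B : Op ι) :
    tensor Ψ Φ (A ⊗ₖ B) = Ψ A ⊗ₖ Φ B := by
  simp [tensor]

/-- Quantum channels: trace-preserving and completely positive super-operators. -/
structure IsChannel (Φ : SuperOp ι) : Prop where
  trace_map : ∀ X : Op ι, (Φ X).trace = X.trace
  completelyPositive : ∀ n : ℕ, 1 ≤ n → ∀ X : Op (ι × Fin n), X.PosSemidef →
    (tensor Φ (LinearMap.id : SuperOp (Fin n)) X).PosSemidef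

/-- The unitary channel `X ↦ U X U†`. -/
def unitaryChannel (U : Op ι) : SuperOp ι where
  toFun X := U * X * Uᴴ
  map_add' X Y := by rw [mul_add, add_mul]
  map_smul' c X := by simp

/-- The class of unitary channels. -/
def unitaryChannels (ι : Type*) [Fintype ι] [DecidableEq ι] : Set (SuperOp ι) :=
  {Λ | ∃ U ∈ Matrix.unitaryGroup ι ℂ, Λ = unitaryChannel U}

/-- The Schur multiplier `X ↦ S ∘ X` (entrywise product). -/
def schurMultiplier (S : Op ι) : SuperOp ι where
  toFun X := S ⊙ X
  map_add' X Y := by ext i j; simp [mul_add]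
  map_smul' c X := by ext i j; simp [mul_left_comm]

/-- The set of Schur channels: Schur multipliers of positive matrices with unit diagonal. -/
def schurChannels (ι : Type*) [Fintype ι] [DecidableEq ι] : Set (SuperOp ι) :=
  {Ψ | ∃ S : Op ι, S.PosSemidef ∧ (∀ k, S k k = 1) ∧ Ψ = schurMultiplier S}

/-- The trace norm `Tr |X|` where `|X| = √(X† X)`. -/
noncomputable def traceNorm (X : Op ι) : ℝ := (CFC.abs X).trace.re

/-- The trace norm of a super-operator, `sup {‖Φ(X)‖₁ : ‖X‖₁ ≤ 1}`, as a supremum in `[0, ∞]`. -/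
noncomputable def superTraceNorm (Φ : SuperOp ι) : ℝ≥0∞ :=
  ⨆ (X : Op ι) (_ : traceNorm X ≤ 1), ENNReal.ofReal (traceNorm (Φ X))

/-- The diamond norm `sup_{n ≥ 1} ‖Φ ⊗ id_n‖₁`, as a supremum in `[0, ∞]`. -/
noncomputable def diamondNorm (Φ : SuperOp ι) : ℝ≥0∞ :=
  ⨆ (n : ℕ) (_ : 1 ≤ n), superTraceNorm (tensor Φ (LinearMap.id : SuperOp (Fin n)))

/-- The diamond-norm distance from a super-operator to a set of super-operators. -/
noncomputable def diamondDist (Φ : SuperOp ι) (C : Set (SuperOp ι)) : ℝ≥0∞ :=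
  ⨅ Λ ∈ C, diamondNorm (Φ - Λ)

/-- `E` is a Kraus representation of `Φ`, i.e. `Φ(X) = ∑ₖ Eₖ X Eₖ†`. -/
def IsKraus (Φ : SuperOp ι) {r : ℕ} (E : Fin r → Op ι) : Prop :=
  ∀ X, Φ X = ∑ k, E k * X * (E k)ᴴ

/-- The Kraus operator space `K(Φ)`: the span of the Kraus operators. All Kraus representations of
`Φ` have the same span (`krausSpace_eq_span`), so that no choice of one is needed. -/
def krausSpace (Φ : SuperOp ι) : Submodule ℂ (Op ι) :=
  Submodule.span ℂ {A | ∃ (r : ℕ) (E : Fin r → Op ι), IsKraus Φ E ∧ A ∈ Set.range E}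

theorem IsKraus.sum_normSq {Φ : SuperOp ι} {r : ℕ} {E : Fin r → Op ι} (hE : IsKraus Φ E)
    (f : Op ι →ₗ[ℂ] ℂ) :
    ∑ i, ∑ j, ∑ k, ∑ l, f (Matrix.single i j 1) * star (f (Matrix.single k l 1)) *
      Φ (Matrix.single j l 1) i k = ((∑ a, Complex.normSq (f (E a)) : ℝ) : ℂ) := by
  have hf : ∀ A : Op ι, f A = ∑ i, ∑ j, f (Matrix.single i j 1) * A i j := by
    intro A
    conv_lhs => rw [Matrix.matrix_eq_sum_single A]
    simp only [map_sum]
    refine Finset.sum_congr rfl fun i _ => Finset.sum_congr rfl fun j _ => ?_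
    have : Matrix.single i j (A i j) = A i j • (Matrix.single i j 1 : Op ι) := by
      simp [Matrix.smul_single]
    rw [this, map_smul, smul_eq_mul, mul_comm]
  have hΦ : ∀ i j k l, Φ (Matrix.single j l 1) i k = ∑ a, E a i j * star (E a k l) := by
    intro i j k l
    rw [hE, Matrix.sum_apply]
    refine Finset.sum_congr rfl fun a _ => ?_
    rw [Matrix.mul_apply, Finset.sum_eq_single l]
    · simp [Matrix.mul_single_apply_same]
    · intro b _ hb
      rw [Matrix.mul_single_apply_of_ne _ _ _ _ _ hb, zero_mul]
    · simp
  push_cast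
  have : ∀ a, ((Complex.normSq (f (E a)) : ℝ) : ℂ) = ∑ i, ∑ j, ∑ k, ∑ l,
      f (Matrix.single i j 1) * star (f (Matrix.single k l 1)) *
        (E a i j * star (E a k l)) := by
    intro a
    rw [← Complex.mul_conj, hf (E a)]
    simp only [map_sum, Finset.sum_mul]
    refine Finset.sum_congr rfl fun i _ => Finset.sum_congr rfl fun j _ => ?_
    simp only [Finset.mul_sum]
    refine Finset.sum_congr rfl fun k _ => Finset.sum_congr rfl fun l _ => ?_
    simp only [map_mul, RCLike.star_def]
    ring
  simp only [this, hΦ, Finset.mul_sum]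
  symm
  iterate 3
    rw [Finset.sum_comm]
    refine Finset.sum_congr rfl fun _ _ => ?_
  rw [Finset.sum_comm]

/-- The Kraus operator space is the span of any one Kraus representation. -/
theorem krausSpace_eq_span {Φ : SuperOp ι} {r : ℕ} {E : Fin r → Op ι} (hE : IsKraus Φ E) :
    krausSpace Φ = Submodule.span ℂ (Set.range E) := by
  refine le_antisymm (Submodule.span_le.2 ?_) (Submodule.span_mono fun A hA => ⟨r, E, hE, hA⟩)
  rintro _ ⟨s, F, hF, b, rfl⟩
  by_contra hb
  obtain ⟨f, hfb, hfE⟩ := Submodule.exists_le_ker_of_notMem hb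
  have h0 : ∀ a, f (E a) = 0 := fun a => hfE (Submodule.subset_span ⟨a, rfl⟩)
  have h := (hF.sum_normSq f).symm.trans (hE.sum_normSq f)
  simp only [h0, map_zero, Finset.sum_const_zero] at h
  rw [Complex.ofReal_inj, Finset.sum_eq_zero_iff_of_nonneg fun _ _ => Complex.normSq_nonneg _] at h
  exact hfb (Complex.normSq_eq_zero.1 (h b (Finset.mem_univ b)))

/-- `C_Φ`, the infimum over `L ∈ K(Φ)` of `Tr (|L| - I)² / d`, with `d` the dimension. It is the
infimum of a non-empty set of non-negative reals, and in fact a minimum. -/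
noncomputable def krausGap (Φ : SuperOp ι) : ℝ :=
  ⨅ L : krausSpace Φ, ((CFC.abs (L : Op ι) - 1) ^ 2).trace.re / Fintype.card ι

end

end QChannel

/-! The proof separates Θ = Ψ ⊗ Φ from the unitary channels by a linear functional on Choi
operators. Writing S as a sum of terms v v† gives Θ the Kraus operators diag(v) ⊗ E_k, which are
block diagonal with blocks in K(Φ) (`choi_tensor_schurMultiplier`). Let W be the space of all such
operators, vectorised, and P the projection onto its complement. Then Tr(P J(Θ)) = 0, while Tr(P
J(U)) is the squared Hilbert–Schmidt distance from U to W.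

That distance is at least md·C_Φ (`krausGap_mul_card_le_re_trace_sub`): against a block diagonal L
only the diagonal blocks U_i of U matter, these are contractions, so Re Tr(U_i† L_i) ≤ Tr|L_i|, and
each block contributes at least Tr(|L_i| − I)² ≥ d·C_Φ. By linearity the bound passes to the convex
hull. Testing the diamond norm on the maximally entangled state, with −P as dual contraction,
divides by md and leaves C_Φ. -/

namespace QChannel

/-! ### Trace-norm duality and the Kraus gap. -/

section TraceNorm

variable {ι : Type*} [Fintype ι] [DecidableEq ι]

/-- Duality between the operator norm and the trace norm: `Re Tr (A L) ≤ Tr |L|` for every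
contraction `A`. -/
theorem re_trace_mul_le_traceNorm {A : Op ι} (hA : (1 - A * Aᴴ).PosSemidef) (L : Op ι) :
    (A * L).trace.re ≤ traceNorm L := by
  have hH : (CFC.abs L).IsHermitian :=
    (Matrix.nonneg_iff_posSemidef.1 (CFC.abs_nonneg L)).isHermitian
  have hpos : (CFC.abs L).PosSemidef := Matrix.nonneg_iff_posSemidef.1 (CFC.abs_nonneg L)
  set V : Op ι := (hH.eigenvectorUnitary : Op ι) with hV
  have hVV : V * Vᴴ = 1 := Matrix.mem_unitaryGroup_iff.1 hH.eigenvectorUnitary.2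
  have hVV' : Vᴴ * V = 1 := Matrix.mem_unitaryGroup_iff'.1 hH.eigenvectorUnitary.2
  set D : Op ι := Matrix.diagonal (fun i => (hH.eigenvalues i : ℂ)) with hD
  have hspec : CFC.abs L = V * D * Vᴴ := by
    have := hH.spectral_theorem
    rw [Unitary.conjStarAlgAut_apply] at this
    exact this
  -- An eigenbasis of |L| replaces the polar decomposition: the columns of `L * V` have the
  -- eigenvalues as norms, the rows of `Vᴴ * A` have norm at most one, and Cauchy–Schwarz applies to
  -- each diagonal entry.
  have hLV : (L * V)ᴴ * (L * V) = D * D := by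
    have h1 : Lᴴ * L = V * D * Vᴴ * (V * D * Vᴴ) := by
      rw [← hspec]; exact (CFC.abs_mul_abs L).symm
    calc (L * V)ᴴ * (L * V) = Vᴴ * (Lᴴ * L) * V := by
          rw [Matrix.conjTranspose_mul]; simp only [Matrix.mul_assoc]
      _ = (Vᴴ * V) * D * (Vᴴ * V) * D * (Vᴴ * V) := by
          rw [h1]; simp only [Matrix.mul_assoc]
      _ = D * D := by simp [hVV']
  have hcol : ∀ i, ∑ k, ‖(L * V) k i‖ ^ 2 = hH.eigenvalues i ^ 2 := by
    intro i
    have h := congrFun (congrFun hLV i) i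
    rw [Matrix.mul_apply, hD, Matrix.diagonal_mul_diagonal, Matrix.diagonal_apply_eq] at h
    simp only [Matrix.conjTranspose_apply, RCLike.star_def, Complex.conj_mul'] at h
    rw [sq]
    exact_mod_cast h
  have hrow : ∀ i, ∑ k, ‖(Vᴴ * A) i k‖ ^ 2 ≤ 1 := by
    intro i
    have h := (hA.conjTranspose_mul_mul_same V).diag_nonneg (i := i)
    have h2 : Vᴴ * (1 - A * Aᴴ) * V = 1 - (Vᴴ * A) * (Vᴴ * A)ᴴ := by
      rw [Matrix.conjTranspose_mul, Matrix.conjTranspose_conjTranspose, Matrix.mul_sub,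
        Matrix.sub_mul, Matrix.mul_one, hVV']
      simp only [Matrix.mul_assoc]
    rw [h2, Matrix.sub_apply, Matrix.one_apply_eq, Matrix.mul_apply] at h
    simp only [Matrix.conjTranspose_apply, RCLike.star_def, Complex.mul_conj'] at h
    rw [sub_nonneg] at h
    exact_mod_cast h
  have htr : (A * L).trace = ((Vᴴ * A) * (L * V)).trace := by
    rw [Matrix.mul_assoc, Matrix.trace_mul_comm Vᴴ, Matrix.mul_assoc, Matrix.mul_assoc, hVV,
      Matrix.mul_one]
  have habs : traceNorm L = ∑ i, hH.eigenvalues i := by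
    rw [traceNorm, hH.trace_eq_sum_eigenvalues]
    simp
  rw [htr, habs, Matrix.trace, Complex.re_sum]
  refine Finset.sum_le_sum fun i _ => ?_
  rw [Matrix.diag_apply, Matrix.mul_apply]
  calc (∑ k, (Vᴴ * A) i k * (L * V) k i).re
      ≤ ‖∑ k, (Vᴴ * A) i k * (L * V) k i‖ := Complex.re_le_norm _
    _ ≤ ∑ k, ‖(Vᴴ * A) i k‖ * ‖(L * V) k i‖ := by
        refine (norm_sum_le _ _).trans_eq (Finset.sum_congr rfl fun k _ => norm_mul _ _)
    _ ≤ √(∑ k, ‖(Vᴴ * A) i k‖ ^ 2) * √(∑ k, ‖(L * V) k i‖ ^ 2) :=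
        Real.sum_mul_le_sqrt_mul_sqrt _ _ _
    _ ≤ 1 * hH.eigenvalues i := by
        rw [hcol, Real.sqrt_sq (hpos.eigenvalues_nonneg i)]
        exact mul_le_mul_of_nonneg_right (Real.sqrt_le_one.2 (hrow i)) (hpos.eigenvalues_nonneg i)
    _ = hH.eigenvalues i := one_mul _

theorem traceNorm_of_posSemidef {X : Op ι} (hX : X.PosSemidef) : traceNorm X = X.trace.re := by
  rw [traceNorm, CFC.abs_of_nonneg X (Matrix.nonneg_iff_posSemidef.2 hX)]

theorem trace_abs_sub_one_sq (L : Op ι) :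
    ((CFC.abs L - 1) ^ 2).trace.re =
      (Lᴴ * L).trace.re - 2 * traceNorm L + Fintype.card ι := by
  have h : (CFC.abs L - 1) ^ 2 = Lᴴ * L - CFC.abs L - CFC.abs L + 1 := by
    have := CFC.abs_mul_abs L
    rw [Matrix.star_eq_conjTranspose] at this
    rw [← this]; noncomm_ring
  rw [h, traceNorm]
  simp only [Matrix.trace_add, Matrix.trace_sub, Matrix.trace_one, Complex.add_re, Complex.sub_re,
    Complex.natCast_re]
  ring

theorem trace_abs_sub_one_sq_nonneg (L : Op ι) : 0 ≤ ((CFC.abs L - 1) ^ 2).trace.re := by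
  have hH : (CFC.abs L - 1).IsHermitian :=
    (Matrix.nonneg_iff_posSemidef.1 (CFC.abs_nonneg L)).isHermitian.sub Matrix.isHermitian_one
  have h := (Matrix.posSemidef_conjTranspose_mul_self (CFC.abs L - 1)).trace_nonneg
  rw [hH.eq, ← sq] at h
  exact (Complex.le_def.1 h).1

theorem krausGap_mul_card_le [Nonempty ι] (Φ : SuperOp ι) {L : Op ι} (hL : L ∈ krausSpace Φ) :
    krausGap Φ * Fintype.card ι ≤
      (Lᴴ * L).trace.re - 2 * traceNorm L + Fintype.card ι := by
  rw [← trace_abs_sub_one_sq, ← le_div_iff₀ (by exact_mod_cast Fintype.card_pos)]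
  refine ciInf_le (f := fun L : krausSpace Φ =>
    ((CFC.abs (L : Op ι) - 1) ^ 2).trace.re / (Fintype.card ι : ℝ)) ⟨0, ?_⟩ ⟨L, hL⟩
  rintro _ ⟨M, rfl⟩
  exact div_nonneg (trace_abs_sub_one_sq_nonneg _) (Nat.cast_nonneg _)

end TraceNorm

/-! ### Distance from unitaries to block diagonal operators. -/

section Blocks

variable {ι κ : Type*} [Fintype ι] [DecidableEq ι] [Fintype κ] [DecidableEq κ]

/-- The `i`-th diagonal block of an operator on `ℂ^κ ⊗ ℂ^ι`. -/
def diagBlock (M : Op (κ × ι)) (i : κ) : Op ι := Matrix.of fun a b => M (i, a) (i, b)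

/-- The block diagonal operators on `ℂ^κ ⊗ ℂ^ι` all of whose diagonal blocks lie in `K`. -/
def blockDiagonalSpace (κ : Type*) (K : Submodule ℂ (Op ι)) : Submodule ℂ (Op (κ × ι)) where
  carrier := {M | (∀ x y, x.1 ≠ y.1 → M x y = 0) ∧ ∀ i, diagBlock M i ∈ K}
  add_mem' {M N} hM hN := ⟨fun x y h => by simp [hM.1 x y h, hN.1 x y h],
    fun i => K.add_mem (hM.2 i) (hN.2 i)⟩
  zero_mem' := ⟨fun _ _ _ => rfl, fun _ => K.zero_mem⟩
  smul_mem' c M hM := ⟨fun x y h => by simp [hM.1 x y h], fun i => K.smul_mem c (hM.2 i)⟩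

omit [DecidableEq ι] [DecidableEq κ] in
theorem trace_conjTranspose_mul_eq_sum_diagBlock (M : Op (κ × ι)) {L : Op (κ × ι)}
    (hL : ∀ x y, x.1 ≠ y.1 → L x y = 0) :
    (Mᴴ * L).trace = ∑ i, ((diagBlock M i)ᴴ * diagBlock L i).trace := by
  simp only [Matrix.trace, Matrix.diag_apply, Matrix.mul_apply, Fintype.sum_prod_type,
    Matrix.conjTranspose_apply]
  refine Finset.sum_congr rfl fun i _ => Finset.sum_congr rfl fun a _ => ?_
  rw [Finset.sum_eq_single i]
  · rfl
  · intro j _ hj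
    exact Finset.sum_eq_zero fun b _ => by rw [hL _ _ hj, mul_zero]
  · simp

/-- The block columns of `U` are isometries, so the defect is `Rᴴ * R`, where `R` is the block
column `i` with its diagonal block set to zero. The double adjoint matches the form `A * Aᴴ` of the
duality lemma. -/
theorem posSemidef_one_sub_diagBlock {U : Op (κ × ι)} (hU : Uᴴ * U = 1) (i : κ) :
    (1 - (diagBlock U i)ᴴ * (diagBlock U i)ᴴᴴ).PosSemidef := by
  let R : Matrix (κ × ι) ι ℂ := Matrix.of fun x b => if x.1 = i then 0 else U x (i, b)
  have : 1 - (diagBlock U i)ᴴ * (diagBlock U i)ᴴᴴ = Rᴴ * R := by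
    rw [Matrix.conjTranspose_conjTranspose, sub_eq_iff_eq_add]
    ext a b
    have h := congrFun (congrFun hU (i, a)) (i, b)
    have h1 : (1 : Op (κ × ι)) (i, a) (i, b) = (1 : Op ι) a b := by
      simp [Matrix.one_apply]
    rw [← h1, ← h]
    simp only [Matrix.add_apply, Matrix.mul_apply, Matrix.conjTranspose_apply,
      Fintype.sum_prod_type]
    rw [← Finset.add_sum_erase _ _ (Finset.mem_univ i),
      ← Finset.add_sum_erase (a := i) _ (fun k => ∑ c, star (R (k, c) a) * R (k, c) b)
        (Finset.mem_univ i)]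
    have h2 : ∑ c, star (R (i, c) a) * R (i, c) b = 0 :=
      Finset.sum_eq_zero fun c _ => by simp [R]
    have h3 : ∀ k ∈ Finset.univ.erase i, ∑ c, star (R (k, c) a) * R (k, c) b =
        ∑ c, star (U (k, c) (i, a)) * U (k, c) (i, b) := by
      intro k hk
      simp [R, Finset.ne_of_mem_erase hk]
    rw [h2, zero_add, Finset.sum_congr rfl h3, add_comm]
    rfl
  rw [this]
  exact Matrix.posSemidef_conjTranspose_mul_self R

/-- Unitaries on `ℂ^κ ⊗ ℂ^ι` are far, in Hilbert-Schmidt norm, from the block diagonal operators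
with blocks in the Kraus space. -/
theorem krausGap_mul_card_le_re_trace_sub [Nonempty ι] (Φ : SuperOp ι) {U : Op (κ × ι)}
    (hU : U ∈ Matrix.unitaryGroup (κ × ι) ℂ) {L : Op (κ × ι)}
    (hL : L ∈ blockDiagonalSpace κ (krausSpace Φ)) :
    krausGap Φ * Fintype.card (κ × ι) ≤ ((U - L)ᴴ * (U - L)).trace.re := by
  have hU' : Uᴴ * U = 1 := Matrix.mem_unitaryGroup_iff'.1 hU
  have hconj : (Lᴴ * U).trace.re = (Uᴴ * L).trace.re := by
    have : (Lᴴ * U).trace = star (Uᴴ * L).trace := by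
      rw [← Matrix.trace_conjTranspose, Matrix.conjTranspose_mul, Matrix.conjTranspose_conjTranspose]
    rw [this]; simp
  have hexp : ((U - L)ᴴ * (U - L)).trace.re =
      Fintype.card (κ × ι) + (Lᴴ * L).trace.re - 2 * (Uᴴ * L).trace.re := by
    rw [Matrix.conjTranspose_sub, Matrix.sub_mul, Matrix.mul_sub, Matrix.mul_sub, hU']
    simp only [Matrix.trace_sub, Matrix.trace_one, Complex.sub_re, Complex.natCast_re, hconj]
    ring
  rw [hexp, trace_conjTranspose_mul_eq_sum_diagBlock U hL.1,
    trace_conjTranspose_mul_eq_sum_diagBlock L hL.1, Complex.re_sum, Complex.re_sum,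
    Fintype.card_prod]
  have hblock : ∀ i, krausGap Φ * Fintype.card ι ≤
      ((diagBlock L i)ᴴ * diagBlock L i).trace.re
        - 2 * ((diagBlock U i)ᴴ * diagBlock L i).trace.re + Fintype.card ι := fun i => by
    have h1 := krausGap_mul_card_le Φ (hL.2 i)
    have h2 := re_trace_mul_le_traceNorm (posSemidef_one_sub_diagBlock hU' i) (diagBlock L i)
    linarith
  have hsum := Finset.sum_le_sum fun i (_ : i ∈ (Finset.univ : Finset κ)) => hblock i
  simp only [Finset.sum_add_distrib, Finset.sum_sub_distrib, ← Finset.mul_sum, Finset.sum_const,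
    Finset.card_univ, nsmul_eq_mul] at hsum
  push_cast
  linarith

end Blocks

/-! ### Choi operators and Kraus decompositions. -/

section Choi

variable {ι κ : Type*} [Fintype ι] [DecidableEq ι] [Fintype κ] [DecidableEq κ]

/-- The (unnormalised) maximally entangled vector of `ℂ^ι ⊗ ℂ^κ`, for an identification of the
index types. -/
def maxEntangledVec (e : ι ≃ κ) : ι × κ → ℂ := fun z => if e z.1 = z.2 then 1 else 0

/-- The (unnormalised) maximally entangled state of `ℂ^ι ⊗ ℂ^κ`. -/
def maxEntangled (e : ι ≃ κ) : Op (ι × κ) :=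
  Matrix.vecMulVec (maxEntangledVec e) (star (maxEntangledVec e))

/-- The Choi operator of a super-operator. -/
def choi (e : ι ≃ κ) (Λ : SuperOp ι) : Op (ι × κ) :=
  Matrix.of fun z w => Λ (Matrix.single (e.symm z.2) (e.symm w.2) 1) z.1 w.1

omit [Fintype κ] in
theorem maxEntangled_eq_sum (e : ι ≃ κ) :
    maxEntangled e = ∑ i, ∑ j, (Matrix.single i j 1 : Op ι) ⊗ₖ
      (Matrix.single (e i) (e j) 1 : Op κ) := by
  ext ⟨i, p⟩ ⟨j, q⟩
  simp only [Matrix.sum_apply, Matrix.kroneckerMap_apply]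
  rw [Finset.sum_eq_single i, Finset.sum_eq_single j]
  · simp [maxEntangled, Matrix.vecMulVec_apply, maxEntangledVec, Matrix.single_apply]
    split_ifs <;> simp_all
  · intro b _ hb; simp [Matrix.single_apply, hb]
  · simp
  · intro b _ hb; exact Finset.sum_eq_zero fun c _ => by simp [Matrix.single_apply, hb]
  · simp

/-- This puts the Choi operator within reach of both complete positivity and the diamond norm. -/
theorem tensor_id_maxEntangled (e : ι ≃ κ) (Λ : SuperOp ι) :
    tensor Λ (LinearMap.id : SuperOp κ) (maxEntangled e) = choi e Λ := by
  ext ⟨i, p⟩ ⟨j, q⟩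
  rw [maxEntangled_eq_sum]
  simp only [map_sum, tensor_kronecker, LinearMap.id_apply, Matrix.sum_apply,
    Matrix.kroneckerMap_apply, choi, Matrix.of_apply]
  rw [Finset.sum_eq_single (e.symm p), Finset.sum_eq_single (e.symm q)]
  · simp
  · intro b _ hb
    have : e b ≠ q := fun h => hb (by rw [← h, e.symm_apply_apply])
    simp [this]
  · simp
  · intro b _ hb
    have : e b ≠ p := fun h => hb (by rw [← h, e.symm_apply_apply])
    exact Finset.sum_eq_zero fun c _ => by simp [this]
  · simp

omit [DecidableEq ι] in
theorem posSemidef_maxEntangled (e : ι ≃ κ) : (maxEntangled e).PosSemidef :=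
  Matrix.posSemidef_vecMulVec_self_star _

omit [DecidableEq ι] in
theorem trace_maxEntangled (e : ι ≃ κ) : (maxEntangled e).trace = Fintype.card ι := by
  simp [Matrix.trace, maxEntangled, maxEntangledVec, Matrix.vecMulVec_apply,
    Fintype.sum_prod_type]

/-- Vectorisation of operators. -/
noncomputable def vec (e : ι ≃ κ) : Op ι →ₗ[ℂ] EuclideanSpace ℂ (ι × κ) where
  toFun M := WithLp.toLp 2 fun z => M z.1 (e.symm z.2)
  map_add' _ _ := rfl
  map_smul' _ _ := rfl

omit [Fintype ι] [DecidableEq ι] [Fintype κ] [DecidableEq κ] in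
theorem vec_ofLp_apply (e : ι ≃ κ) (M : Op ι) (z : ι × κ) :
    (vec e M).ofLp z = M z.1 (e.symm z.2) := rfl

omit [DecidableEq ι] [DecidableEq κ] in
theorem norm_vec_sq (e : ι ≃ κ) (M : Op ι) : ‖vec e M‖ ^ 2 = (Mᴴ * M).trace.re := by
  rw [EuclideanSpace.norm_sq_eq, Fintype.sum_prod_type, Matrix.trace, Complex.re_sum,
    Finset.sum_comm, ← e.sum_comp]
  refine Finset.sum_congr rfl fun j _ => ?_
  rw [Matrix.diag_apply, Matrix.mul_apply, Complex.re_sum]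
  refine Finset.sum_congr rfl fun i _ => ?_
  simp only [vec_ofLp_apply, e.symm_apply_apply, Matrix.conjTranspose_apply, RCLike.star_def, Complex.conj_mul']
  norm_cast

theorem mul_single_mul_conjTranspose_apply (K : Op ι) (i j k l : ι) :
    (K * Matrix.single j l 1 * Kᴴ : Op ι) i k = K i j * star (K k l) := by
  rw [Matrix.mul_apply, Finset.sum_eq_single l]
  · simp [Matrix.mul_single_apply_same]
  · intro b _ hb
    rw [Matrix.mul_single_apply_of_ne _ _ _ _ _ hb, zero_mul]
  · simp

omit [Fintype κ] [DecidableEq κ] in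
theorem choi_unitaryChannel (e : ι ≃ κ) (U : Op ι) :
    choi e (unitaryChannel U) = Matrix.vecMulVec (vec e U).ofLp (star (vec e U).ofLp) := by
  ext z w
  exact mul_single_mul_conjTranspose_apply _ _ _ _ _

omit [Fintype ι] [DecidableEq ι] in
theorem schurMultiplier_apply (S X : Op ι) : schurMultiplier S X = S ⊙ X := rfl

/-- Choi's theorem: completely positive maps have Kraus representations. -/
theorem IsChannel.exists_isKraus {d : ℕ} (hd : 1 ≤ d) {Φ : SuperOp (Fin d)} (hΦ : IsChannel Φ) :
    ∃ (r : ℕ) (E : Fin r → Op (Fin d)), IsKraus Φ E := by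
  have h := hΦ.completelyPositive d hd _ (posSemidef_maxEntangled (Equiv.refl _))
  rw [tensor_id_maxEntangled] at h
  -- The vectors of a rank-one decomposition of the Choi operator, reshaped into matrices, are Kraus
  -- operators.
  obtain ⟨r, v, hv⟩ := Matrix.posSemidef_iff_eq_sum_vecMulVec.1 h
  refine ⟨r, fun a => Matrix.of fun i j => v a (i, j), fun X => ?_⟩
  set E : Fin r → Op (Fin d) := fun a => Matrix.of fun i j => v a (i, j) with hE
  have hsingle : ∀ j l, Φ (Matrix.single j l 1) = ∑ a, E a * Matrix.single j l 1 * (E a)ᴴ := by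
    intro j l
    ext i k
    have := congrFun (congrFun hv (i, j)) (k, l)
    simp only [Matrix.sum_apply, mul_single_mul_conjTranspose_apply]
    simpa [hE, choi, Matrix.sum_apply, Matrix.vecMulVec_apply] using this
  have hX : X = ∑ j, ∑ l, X j l • (Matrix.single j l 1 : Op (Fin d)) := by
    conv_lhs => rw [Matrix.matrix_eq_sum_single X]
    simp [Matrix.smul_single]
  conv_lhs => rw [hX]
  conv_rhs => rw [hX]
  simp only [map_sum, map_smul, hsingle, Finset.mul_sum, Finset.sum_mul, Finset.smul_sum,
    Matrix.mul_smul, Matrix.smul_mul]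
  symm
  rw [Finset.sum_comm]
  refine Finset.sum_congr rfl fun j _ => ?_
  rw [Finset.sum_comm]

/-- The Choi operator of the tensor product of a Schur channel and a channel is a sum of rank-one
operators, on block diagonal operators with blocks in the Kraus space. -/
theorem choi_tensor_schurMultiplier {γ : Type*} [Fintype γ] [DecidableEq γ] (e : κ × ι ≃ γ)
    {S : Op κ} (hS : S.PosSemidef) {Φ : SuperOp ι} {r : ℕ} {E : Fin r → Op ι} (hE : IsKraus Φ E) :
    ∃ (s : ℕ) (G : Fin s × Fin r → Op (κ × ι)),
      (∀ t, G t ∈ blockDiagonalSpace κ (krausSpace Φ)) ∧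
      choi e (tensor (schurMultiplier S) Φ) =
        ∑ t, Matrix.vecMulVec (vec e (G t)).ofLp (star (vec e (G t)).ofLp) := by
  obtain ⟨s, v, hv⟩ := Matrix.posSemidef_iff_eq_sum_vecMulVec.1 hS
  -- Schur multiplication by v v† is conjugation by diag(v).
  refine ⟨s, fun t => Matrix.diagonal (v t.1) ⊗ₖ E t.2, fun t => ⟨?_, fun i => ?_⟩, ?_⟩
  · rintro ⟨i, a⟩ ⟨j, b⟩ (h : i ≠ j)
    simp [Matrix.kroneckerMap_apply, h]
  · have : diagBlock (Matrix.diagonal (v t.1) ⊗ₖ E t.2) i = v t.1 i • E t.2 := by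
      ext a b; simp [diagBlock, Matrix.kroneckerMap_apply]
    rw [this]
    exact Submodule.smul_mem _ _ (Submodule.subset_span ⟨r, E, hE, t.2, rfl⟩)
  · ext ⟨⟨i, a⟩, p⟩ ⟨⟨j, b⟩, q⟩
    obtain ⟨⟨i', a'⟩, rfl⟩ := e.surjective p
    obtain ⟨⟨j', b'⟩, rfl⟩ := e.surjective q
    have hsingle : (Matrix.single (i', a') (j', b') 1 : Op (κ × ι)) =
        Matrix.single i' j' 1 ⊗ₖ Matrix.single a' b' 1 := by
      rw [Matrix.single_kronecker_single, one_mul]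
    have hSij : S i j = ∑ x, v x i * star (v x j) := by
      rw [hv]; simp [Matrix.sum_apply, Matrix.vecMulVec_apply]
    have hΦab : Φ (Matrix.single a' b' 1) a b = ∑ k, E k a a' * star (E k b b') := by
      rw [hE, Matrix.sum_apply]
      simp only [mul_single_mul_conjTranspose_apply]
    simp only [choi, Matrix.of_apply, e.symm_apply_apply, hsingle, tensor_kronecker,
      Matrix.kroneckerMap_apply, hΦab, Matrix.sum_apply, Matrix.vecMulVec_apply,
      vec_ofLp_apply, Pi.star_apply, schurMultiplier_apply, Matrix.hadamard_apply,
      hSij, Fintype.sum_prod_type, Matrix.single_apply,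
      Matrix.diagonal_apply]
    rw [mul_right_comm, Finset.sum_mul_sum, Finset.sum_mul]
    refine Finset.sum_congr rfl fun x _ => ?_
    rw [Finset.sum_mul]
    refine Finset.sum_congr rfl fun k _ => ?_
    by_cases h1 : i = i' <;> by_cases h2 : j = j' <;>
      simp [h1, h2, eq_comm] <;> ring

end Choi

/-! ### The separating projection. -/

section Witness

variable {n : Type*} [Fintype n] [DecidableEq n]

/-- The matrix of the orthogonal projection onto the orthogonal complement of `W`. -/
noncomputable def complProj (W : Submodule ℂ (EuclideanSpace ℂ n)) : Op n :=
  (Matrix.toEuclideanCLM (n := n) (𝕜 := ℂ)).symm Wᗮ.starProjection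

theorem isStarProjection_complProj (W : Submodule ℂ (EuclideanSpace ℂ n)) :
    IsStarProjection (complProj W) :=
  (isStarProjection_starProjection (U := Wᗮ)).map (Matrix.toEuclideanCLM (n := n) (𝕜 := ℂ)).symm

theorem posSemidef_one_sub_neg_complProj (W : Submodule ℂ (EuclideanSpace ℂ n)) :
    (1 - -complProj W * (-complProj W)ᴴ).PosSemidef := by
  have h := isStarProjection_complProj W
  have h1 : -complProj W * (-complProj W)ᴴ = complProj W := by
    rw [Matrix.conjTranspose_neg, neg_mul_neg, ← Matrix.star_eq_conjTranspose,
      h.isSelfAdjoint.star_eq, h.isIdempotentElem.eq]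
  rw [h1]
  exact Matrix.nonneg_iff_posSemidef.1 h.one_sub_nonneg

/-- Both sides are the squared norm of the component of `u` orthogonal to `W`; this turns the
witness into a distance. -/
theorem re_trace_complProj_mul_vecMulVec (W : Submodule ℂ (EuclideanSpace ℂ n))
    (u : EuclideanSpace ℂ n) :
    (complProj W * Matrix.vecMulVec u.ofLp (star u.ofLp)).trace.re =
      ‖u - W.starProjection u‖ ^ 2 := by
  have h1 : complProj W *ᵥ u.ofLp = (Wᗮ.starProjection u).ofLp := by
    rw [← Matrix.ofLp_toEuclideanCLM, complProj, StarAlgEquiv.apply_symm_apply]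
  have h2 := Wᗮ.re_inner_starProjection_eq_normSq u
  rw [← Submodule.norm_coe, ← Submodule.starProjection_apply, inner_re_symm,
    EuclideanSpace.inner_eq_star_dotProduct] at h2
  rw [Matrix.mul_vecMulVec, Matrix.trace_vecMulVec, h1, ← W.starProjection_orthogonal_val]
  exact h2

end Witness

/-! ### Lower bound on the diamond distance. -/

section Main

variable {ι κ : Type*} [Fintype ι] [DecidableEq ι] [Fintype κ] [DecidableEq κ]

theorem ofReal_traceNorm_le_diamondNorm (Δ : SuperOp ι) {n : ℕ} (hn : 1 ≤ n) {X : Op (ι × Fin n)}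
    (hX : traceNorm X ≤ 1) :
    ENNReal.ofReal (traceNorm (tensor Δ (LinearMap.id : SuperOp (Fin n)) X)) ≤ diamondNorm Δ :=
  (le_iSup₂_of_le (f := fun (X : Op (ι × Fin n)) (_ : traceNorm X ≤ 1) => ENNReal.ofReal
      (traceNorm (tensor Δ (LinearMap.id : SuperOp (Fin n)) X))) X hX le_rfl).trans
    (le_iSup₂_of_le (f := fun (n : ℕ) (_ : 1 ≤ n) =>
      superTraceNorm (tensor Δ (LinearMap.id : SuperOp (Fin n)))) n hn le_rfl)

/-- The trace norm of the normalised Choi operator bounds the diamond norm from below. -/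
theorem ofReal_traceNorm_choi_le_diamondNorm [Nonempty ι] {n : ℕ} (e : ι ≃ Fin n)
    (Δ : SuperOp ι) :
    ENNReal.ofReal (traceNorm ((Fintype.card ι : ℂ)⁻¹ • choi e Δ)) ≤ diamondNorm Δ := by
  have hn : 1 ≤ n := by
    have := Fintype.card_congr e
    rw [Fintype.card_fin] at this
    rw [← this]; exact Fintype.card_pos
  have h0 : (Fintype.card ι : ℂ) ≠ 0 := by exact_mod_cast Fintype.card_ne_zero
  rw [← tensor_id_maxEntangled, ← map_smul]
  refine ofReal_traceNorm_le_diamondNorm Δ hn (le_of_eq ?_)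
  rw [traceNorm_of_posSemidef ((posSemidef_maxEntangled e).smul (by simp)), Matrix.trace_smul,
    trace_maxEntangled, smul_eq_mul, inv_mul_cancel₀ h0, Complex.one_re]

theorem krausGap_le_diamondDist [Nonempty ι] [Nonempty κ] {S : Op κ} (hS : S.PosSemidef)
    {Φ : SuperOp ι} {r : ℕ} {E : Fin r → Op ι} (hE : IsKraus Φ E) :
    ENNReal.ofReal (krausGap Φ) ≤ diamondDist (tensor (schurMultiplier S) Φ)
      (convexHull ℝ (unitaryChannels (κ × ι))) := by
  -- The ancillas in the diamond norm are indexed by `Fin n`, so the basis has to be numbered.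
  let e := Fintype.equivFin (κ × ι)
  set N : ℝ := (Fintype.card (κ × ι) : ℝ) with hN
  have hNpos : 0 < N := by rw [hN]; exact_mod_cast Fintype.card_pos
  set W := (blockDiagonalSpace κ (krausSpace Φ)).map (vec e) with hW
  set P := complProj W
  have hΘ : (P * choi e (tensor (schurMultiplier S) Φ)).trace.re = 0 := by
    obtain ⟨s, G, hG, h⟩ := choi_tensor_schurMultiplier e hS hE
    rw [h, Finset.mul_sum, Matrix.trace_sum, Complex.re_sum]
    refine Finset.sum_eq_zero fun t _ => ?_
    rw [re_trace_complProj_mul_vecMulVec,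
      Submodule.starProjection_eq_self_iff.2 (Submodule.mem_map_of_mem (hG t))]
    simp
  have hlin : IsLinearMap ℝ fun Λ : SuperOp (κ × ι) => (P * choi e Λ).trace.re := by
    refine ⟨fun Λ Λ' => ?_, fun c Λ => ?_⟩
    · have : choi e (Λ + Λ') = choi e Λ + choi e Λ' := rfl
      rw [this, Matrix.mul_add, Matrix.trace_add, Complex.add_re]
    · have : choi e (c • Λ) = c • choi e Λ := rfl
      rw [this, Matrix.mul_smul, Matrix.trace_smul, Complex.smul_re]
  have hΛ : convexHull ℝ (unitaryChannels (κ × ι)) ⊆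
      {Λ | krausGap Φ * N ≤ (P * choi e Λ).trace.re} := by
    refine convexHull_min ?_ (convex_halfSpace_ge hlin _)
    rintro _ ⟨U, hU, rfl⟩
    -- `L` is the block diagonal operator nearest to `U`.
    obtain ⟨L, hL, hLU⟩ := W.starProjection_apply_mem (vec e U)
    rw [Set.mem_ofPred_eq, choi_unitaryChannel, re_trace_complProj_mul_vecMulVec, ← hLU, ← map_sub,
      norm_vec_sq]
    exact krausGap_mul_card_le_re_trace_sub Φ hU hL
  refine le_iInf₂ fun Λ hmem => le_trans (ENNReal.ofReal_le_ofReal ?_)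
    (ofReal_traceNorm_choi_le_diamondNorm e _)
  -- The sign of −P makes the contribution of Λ positive, since that of Θ vanishes.
  refine le_trans ?_ (re_trace_mul_le_traceNorm (posSemidef_one_sub_neg_complProj W) _)
  have hsub : choi e (tensor (schurMultiplier S) Φ - Λ) =
      choi e (tensor (schurMultiplier S) Φ) - choi e Λ := rfl
  have hcast : ((Fintype.card (κ × ι) : ℂ))⁻¹ = ((N⁻¹ : ℝ) : ℂ) := by simp [hN]
  rw [hcast, Matrix.mul_smul, Matrix.trace_smul, smul_eq_mul, Complex.re_ofReal_mul, hsub,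
    Matrix.neg_mul, Matrix.trace_neg, Matrix.mul_sub, Matrix.trace_sub, Complex.neg_re,
    Complex.sub_re, hΘ, zero_sub, neg_neg, inv_mul_eq_div, le_div_iff₀ hNpos]
  exact hΛ hmem

end Main

end QChannel

theorem theorem2 (m d : ℕ) (hm : 1 ≤ m) (hd : 1 ≤ d)
    (Φ : QChannel.SuperOp (Fin d)) (hΦ : QChannel.IsChannel Φ)
    (Ψ : QChannel.SuperOp (Fin m)) (hΨ : Ψ ∈ QChannel.schurChannels (Fin m)) :
    ENNReal.ofReal (QChannel.krausGap Φ) ≤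
      QChannel.diamondDist (QChannel.tensor Ψ Φ)
        (convexHull ℝ (QChannel.unitaryChannels (Fin m × Fin d))) := by
  obtain ⟨S, hS, -, rfl⟩ := hΨ
  obtain ⟨r, E, hE⟩ := hΦ.exists_isKraus hd
  have : NeZero m := ⟨by omega⟩
  have : NeZero d := ⟨by omega⟩
  exact QChannel.krausGap_le_diamondDist hS hE
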